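/- For a subset $X$ of the Euclidean space $\mathbb{R}^d$ let $A(X)=\{\|x-y\| : x,y\in X,\ x\neq y\}$ be the set of Euclidean distances between distinct points of $X$; $X$ is called an $s$-distance set if $|A(X)|=s$. Call two subsets of $\mathbb{R}^d$ equivalent if one is the image of the other under a similarity transformation of $\mathbb{R}^d$, i.e. a congruence (isometry of $\mathbb{R}^d$) composed with a scaling by a positive factor. Then for all fixed integers $d,s\ge 0$, with the convention $\binom{n}{k}=0$ unless $0\le k\le n$, there are only finitely many equivalence classes of $s$-distance sets $X\subset\mathbb{R}^d$ with $$|X|\ \ge\ 2\binom{d+s-1}{s-1}+2\binom{d+s-2}{s-2}.$$ -/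

import Mathlib

/-- The set `A(X)` of Euclidean distances between two distinct points of `X ⊆ ℝ^d`. -/
def distanceSet {d : ℕ} (X : Set (EuclideanSpace ℝ (Fin d))) : Set ℝ :=
  {a | ∃ x ∈ X, ∃ y ∈ X, x ≠ y ∧ dist x y = a}

/-- `X ⊆ ℝ^d` is an `s`-distance set: exactly `s` distances occur between distinct points. -/
def IsSDistanceSet {d : ℕ} (s : ℕ) (X : Set (EuclideanSpace ℝ (Fin d))) : Prop :=
  (distanceSet X).encard = s

/-- The binomial coefficient with integer entries, equal to `0` unless `0 ≤ k ≤ n`. -/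
def intBinom (n k : ℤ) : ℕ :=
  if 0 ≤ k ∧ k ≤ n then n.toNat.choose k.toNat else 0

/-- Two subsets of `ℝ^d` are equivalent if a similarity transformation of `ℝ^d`
(a congruence composed with a scaling by a positive factor) maps one onto the other. -/
def similaritySetoid (d : ℕ) : Setoid (Set (EuclideanSpace ℝ (Fin d))) where
  r X Y := ∃ f : EuclideanSpace ℝ (Fin d) ≃ᵈ EuclideanSpace ℝ (Fin d), f '' X = Y
  iseqv :=
    { refl := fun X => ⟨DilationEquiv.refl _, by simp⟩
      symm := by
        rintro X Y ⟨f, rfl⟩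
        refine ⟨f.symm, ?_⟩
        rw [Set.image_image]
        simp
      trans := by
        rintro X Y Z ⟨f, rfl⟩ ⟨g, rfl⟩
        refine ⟨f.trans g, ?_⟩
        rw [Set.image_image]
        rfl }

/-! Let the squared distances be `α i`, with `s ≥ 1` of them, and let `K i = ∏ j ≠ i, α j / (α j - α
i)`. Let `A i` be the adjacency matrix of the graph of pairs at the `i`-th distance. Up to a scalar,
the entries of `K i • 1 + A i` are `∏ j ≠ i, (α j - dist ^ 2)`, so its rank is at most half the
bound of the theorem (`rank_prod_const_sub_dist_sq_le`). Hence `-K i` is an eigenvalue of `A i`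
whose multiplicity is at least half of `|X|`, which forces `K i` to be an integer with `|K i| ≤ |X|`
(`SimpleGraph.exists_int_of_rank_le`). The product over all `s` distances bounds `|X|` in the same
way, so only finitely many tuples `K` occur.

Each `K` leaves finitely many ratios of the `α i` (`finite_setOf_lagrangeAtZero_eq`). Interpolation
gives `∑ K i * α i ^ k = 0` for `0 < k < s`. With one `α i` scaled to `1`, differentiating these
relations and arguing as for a Vandermonde system kills every `dα i`, so the ring of functions on
the solutions is unramified and the solutions are finite in number. Finitely many distance tables
remain, and a table determines a point set up to congruence. -/

/-! ### Dimension counts for polynomials in the coordinates and the quadratic form -/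

open Submodule in
/-- The `k`-th power of the span of a finite family is spanned by the products of `k` members. -/
theorem span_range_pow_le {F A ι : Type*} [Field F] [CommRing A] [Algebra F A]
    (g : ι → A) (k : ℕ) :
    (span F (Set.range g)) ^ k ≤
      span F (Set.range fun σ : Sym ι k => ((σ : Multiset ι).map g).prod) := by
  induction k with
  | zero =>
    rw [pow_zero, one_eq_span, span_le, Set.singleton_subset_iff]
    exact subset_span ⟨Sym.nil, by simp⟩
  | succ k ih =>
    rw [pow_succ]
    refine (mul_le_mul' ih le_rfl).trans ?_
    rw [span_mul_span, span_le]
    rintro _ ⟨_, ⟨σ, rfl⟩, _, ⟨i, rfl⟩, rfl⟩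
    exact subset_span ⟨i ::ₛ σ,
      (congrArg Multiset.prod (Multiset.map_cons g i σ)).trans (by simp [mul_comm])⟩

open Submodule in
theorem finrank_mul_span_range_pow_le {F A ι : Type*} [Field F] [CommRing A] [Algebra F A]
    [Fintype ι] [FiniteDimensional F A] (a : A) (g : ι → A) (k : ℕ) :
    Module.finrank F ↥(span F {a} * (span F (Set.range g)) ^ k) ≤
      (Fintype.card ι).multichoose k := by
  classical
  have h : span F {a} * (span F (Set.range g)) ^ k ≤
      span F (Set.range fun σ : Sym ι k => a * ((σ : Multiset ι).map g).prod) := by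
    refine (mul_le_mul' le_rfl (span_range_pow_le g k)).trans ?_
    rw [span_mul_span, span_le]
    rintro _ ⟨_, rfl, _, ⟨σ, rfl⟩, rfl⟩
    exact subset_span ⟨σ, rfl⟩
  refine (Submodule.finrank_mono h).trans ?_
  rw [← Sym.card_sym_eq_multichoose]
  exact finrank_range_le_card _

/-- In an idempotent commutative semiring of submodules: if `Z ≤ Y ^ 2`, then every monomial of
degree at most `k` in `1`, `Y`, `Z` is at most `(1 ⊔ Y) ^ k ⊔ Z * (Z ⊔ Y) ^ (k - 1)`. -/
theorem pow_one_sup_sup_le {F A : Type*} [Field F] [CommRing A] [Algebra F A]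
    (Y Z : Submodule F A) (hZ : Z ≤ Y ^ 2) (k : ℕ) :
    (1 ⊔ (Z ⊔ Y)) ^ (k + 1) ≤ (1 ⊔ Y) ^ (k + 1) ⊔ Z * (Z ⊔ Y) ^ k := by
  have mono : ∀ a b : ℕ, a + b ≤ k + 1 →
      Z ^ a * Y ^ b ≤ (1 ⊔ Y) ^ (k + 1) ⊔ Z * (Z ⊔ Y) ^ k := by
    intro a
    induction a with
    | zero =>
      intro b hb
      rw [pow_zero, one_mul]
      exact ((pow_le_pow_left' le_sup_right b).trans
        (pow_le_pow_right' le_sup_left (by omega))).trans le_sup_left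
    | succ a ih =>
      intro b hb
      -- In top degree a factor `Z` can be split off. In lower degree there is room to trade one `Z`
      -- for `Y ^ 2`, which raises the degree by one.
      rcases (show a + b = k ∨ a + b < k by omega) with h | h
      · refine le_trans ?_ le_sup_right
        rw [pow_succ', mul_assoc, ← h, pow_add]
        exact mul_le_mul_right (mul_le_mul' (pow_le_pow_left' le_sup_left a)
          (pow_le_pow_left' le_sup_right b)) _
      · refine le_trans ?_ (ih (b + 2) (by omega))
        rw [pow_succ, mul_assoc, pow_add, mul_comm (Y ^ b)]
        exact mul_le_mul_right (mul_le_mul_left hZ _) _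
  have key : ∀ m a b : ℕ, a + b + m ≤ k + 1 →
      Z ^ a * Y ^ b * (1 ⊔ (Z ⊔ Y)) ^ m ≤ (1 ⊔ Y) ^ (k + 1) ⊔ Z * (Z ⊔ Y) ^ k := by
    intro m
    induction m with
    | zero => intro a b h; simpa using mono a b (by omega)
    | succ m ih =>
      intro a b h
      rw [pow_succ', ← mul_assoc, Submodule.mul_sup, Submodule.mul_sup, Submodule.sup_mul,
        Submodule.sup_mul, mul_one]
      refine sup_le (ih a b (by omega)) (sup_le ?_ ?_)
      · rw [mul_right_comm (Z ^ a), ← pow_succ]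
        exact ih (a + 1) b (by omega)
      · rw [mul_assoc (Z ^ a), ← pow_succ]
        exact ih a (b + 1) (by omega)
  simpa using key (k + 1) 0 0 (by omega)

/-- The span of `1`, the coordinates `y j` and the quadratic form `∑ j, y j ^ 2`. -/
def quadricSpan (F : Type*) {A : Type*} [Field F] [CommRing A] [Algebra F A] {d : ℕ}
    (y : Fin d → A) : Submodule F A :=
  1 ⊔ (Submodule.span F {∑ j, y j ^ 2} ⊔ Submodule.span F (Set.range y))

/-- The number of monomials bounding the dimension of `quadricSpan F y ^ k`. -/
def quadricDim (d : ℕ) : ℕ → ℕ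
  | 0 => 1
  | k + 1 => (d + (k + 1)).choose (k + 1) + (d + k).choose k

-- The quadratic form lies in the square of the span of the coordinates, so only two kinds of
-- monomials are needed: degree `k + 1` in `1, y`, and the form times degree `k` in the form and
-- `y`. Both kinds use `d + 1` generators.
open Submodule in
theorem finrank_quadricSpan_pow_le {F A : Type*} [Field F] [CommRing A] [Algebra F A]
    [FiniteDimensional F A] {d : ℕ} (y : Fin d → A) (k : ℕ) :
    Module.finrank F ↥(quadricSpan F y ^ k) ≤ quadricDim d k := by
  have sup_eq : ∀ a : A, span F {a} ⊔ span F (Set.range y) =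
      span F (Set.range fun o : Option (Fin d) => o.elim a y) := by
    intro a
    rw [← span_union]
    congr 1
    ext b
    simp [Option.exists, eq_comm]
  have multichoose_eq : ∀ m, (Fintype.card (Option (Fin d))).multichoose m = (d + m).choose m := by
    intro m
    rw [Nat.multichoose_eq]
    simp [show d + 1 + m - 1 = d + m by omega]
  cases k with
  | zero =>
    rw [pow_zero, one_eq_span, quadricDim]
    simpa using finrank_span_le_card (R := F) ({1} : Set A)
  | succ k =>
    have hZ : span F {∑ j, y j ^ 2} ≤ span F (Set.range y) ^ 2 := by
      rw [span_le, Set.singleton_subset_iff]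
      refine Submodule.sum_mem _ fun j _ => ?_
      rw [pow_two, pow_two]
      exact Submodule.mul_mem_mul (subset_span ⟨j, rfl⟩) (subset_span ⟨j, rfl⟩)
    refine (Submodule.finrank_mono (pow_one_sup_sup_le _ _ hZ k)).trans ?_
    refine (Submodule.finrank_add_le_finrank_add_finrank _ _).trans ?_
    rw [quadricDim, ← multichoose_eq, ← multichoose_eq, one_eq_span, sup_eq, sup_eq]
    refine add_le_add ?_ (finrank_mul_span_range_pow_le _ _ _)
    have := finrank_mul_span_range_pow_le (F := F) 1 (fun o : Option (Fin d) => o.elim 1 y) (k + 1)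
    rwa [← one_eq_span, one_mul] at this

/-! ### Graph eigenvalues of large multiplicity -/

open Polynomial in
/-- If an algebraic number is a root of multiplicity `m` of a rational polynomial, then the `m`-th
power of its minimal polynomial divides that polynomial. -/
theorem minpoly_pow_dvd_of_le_rootMultiplicity {μ : ℝ} (hμ : IsIntegral ℚ μ) (m : ℕ) :
    ∀ f : ℚ[X], f ≠ 0 → m ≤ (f.map (algebraMap ℚ ℝ)).rootMultiplicity μ → minpoly ℚ μ ^ m ∣ f := by
  induction m with
  | zero => intro f _ _; simp
  | succ m ih =>
    intro f hf hm
    have hf' : f.map (algebraMap ℚ ℝ) ≠ 0 :=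
      (Polynomial.map_ne_zero_iff (algebraMap ℚ ℝ).injective).2 hf
    have hroot : aeval μ f = 0 := by
      have := (rootMultiplicity_pos hf').1 (Nat.lt_of_lt_of_le (Nat.succ_pos m) hm)
      rwa [IsRoot, eval_map_algebraMap] at this
    obtain ⟨q, rfl⟩ := minpoly.dvd ℚ μ hroot
    rw [Polynomial.map_mul] at hf' hm
    rw [rootMultiplicity_mul hf'] at hm
    -- Separability makes the root simple in the minimal polynomial, so the quotient `q` loses only
    -- one unit of multiplicity.
    have hsep : ((minpoly ℚ μ).map (algebraMap ℚ ℝ)).Separable :=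
      (minpoly.irreducible hμ).separable.map
    have h1 := rootMultiplicity_le_one_of_separable hsep μ
    rw [pow_succ']
    exact mul_dvd_mul_left _ (ih q (right_ne_zero_of_mul hf) (by omega))

/-- A symmetric rational `C` with `C ^ 2 = 0` satisfies `Cᵀ * C = 0`, hence vanishes. Rounding the
exponent up to a power of two allows repeated halving. -/
theorem Matrix.IsSymm.eq_zero_of_pow_eq_zero {n : Type*} [Fintype n] [DecidableEq n]
    {B : Matrix n n ℚ} (hB : B.IsSymm) {m : ℕ} (h : B ^ m = 0) : B = 0 := by
  have key : ∀ k : ℕ, B ^ (2 ^ k) = 0 → B = 0 := by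
    intro k
    induction k with
    | zero => intro h; simpa using h
    | succ k ih =>
      intro h
      refine ih (Matrix.conjTranspose_mul_self_eq_zero.1 ?_)
      have hs : (B ^ 2 ^ k).conjTranspose = B ^ 2 ^ k := by
        rw [Matrix.conjTranspose_pow, Matrix.conjTranspose_eq_transpose_of_trivial, hB]
      rw [hs, ← pow_add, ← two_mul, ← pow_succ', h]
  exact key m (pow_eq_zero_of_le Nat.lt_two_pow_self.le h)

theorem Matrix.finrank_eigenspace_toLin' {n : Type*} [Fintype n] [DecidableEq n]
    (A : Matrix n n ℝ) (K : ℝ) :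
    Module.finrank ℝ (Module.End.eigenspace (Matrix.toLin' A) (-K)) + (K • 1 + A).rank =
      Fintype.card n := by
  have h : (Matrix.toLin' A) - (-K) • 1 =
      (K • 1 + A).mulVecLin := by
    ext i j
    simp [add_comm]
  rw [Module.End.eigenspace_def, h, Matrix.rank, add_comm, LinearMap.finrank_range_add_finrank_ker]
  simp

open Polynomial in
/-- A quadratic irrationality cannot be the only eigenvalue, up to conjugation, of a graph. -/
theorem SimpleGraph.charpoly_adjMatrix_ne_pow {V : Type*} [Fintype V] [DecidableEq V] [Nonempty V]
    (G : SimpleGraph V) [DecidableRel G.Adj] {p : ℚ[X]} (hp : Irreducible p) (hmonic : p.Monic)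
    (hdeg : p.natDegree = 2) (m : ℕ) : (G.adjMatrix ℚ).charpoly ≠ p ^ m := by
  intro h
  have hexp : p = X ^ 2 + C (p.coeff 1) * X + C (p.coeff 0) := by
    conv_lhs => rw [hmonic.as_sum, hdeg]
    simp [Finset.sum_range_succ]
    ring
  set b := p.coeff 1
  set c := p.coeff 0
  set A := G.adjMatrix ℚ with hA
  have haeval : aeval A p = A * A + b • A + c • 1 := by
    conv_lhs => rw [hexp]
    simp [Algebra.algebraMap_eq_smul_one, pow_two]
  have hsymm : A.IsSymm := G.isSymm_adjMatrix
  have hzero : A * A + b • A + c • 1 = 0 := by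
    refine Matrix.IsSymm.eq_zero_of_pow_eq_zero (m := m) ?_ ?_
    · simp [Matrix.IsSymm, Matrix.transpose_mul, hsymm.eq]
    · rw [← haeval, ← map_pow, ← h]
      exact Matrix.aeval_self_charpoly A
  -- Diagonal entries: `A * A` has the degrees there and `A` has zeros. The graph is thus regular,
  -- and the constant vector gives `p` a rational root.
  have hdegree : ∀ v, (G.degree v : ℚ) + c = 0 := by
    intro v
    have := congrFun (congrFun hzero v) v
    rw [Matrix.add_apply, Matrix.add_apply, hA, SimpleGraph.adjMatrix_mul_self_apply_self] at this
    simpa using this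
  obtain ⟨v⟩ := ‹Nonempty V›
  have hrow : A.mulVec (fun _ => (1 : ℚ)) = fun _ => -c := by
    ext w
    have := hdegree w
    rw [hA, SimpleGraph.adjMatrix_mulVec_apply]
    simp
    linarith
  have hrow' : ∀ t : ℚ, A.mulVec (fun _ => t) = fun _ => -c * t := by
    intro t
    have : (fun _ : V => t) = t • fun _ : V => (1 : ℚ) := by ext; simp
    rw [this, Matrix.mulVec_smul, hrow]
    ext; simp [mul_comm]
  have hroot : p.IsRoot (-c) := by
    have := congrFun (congrArg (fun B => Matrix.mulVec B fun _ => (1 : ℚ)) hzero) v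
    simp only [Matrix.add_mulVec, Matrix.smul_mulVec, ← Matrix.mulVec_mulVec, hrow', Pi.add_apply,
      Pi.smul_apply, Matrix.one_mulVec, smul_eq_mul, Matrix.zero_mulVec, Pi.zero_apply] at this
    rw [IsRoot, hexp]
    simp only [eval_add, eval_pow, eval_mul, eval_X, eval_C]
    linarith
  have : p.natDegree = 1 :=
    natDegree_eq_of_degree_eq_some (degree_eq_one_of_irreducible_of_root hp hroot)
  omega

open Polynomial in
/-- An eigenvalue of a graph whose multiplicity is at least half the number of vertices is an
integer, bounded by the number of vertices. -/
theorem SimpleGraph.exists_int_of_rank_le {V : Type*} [Fintype V] [DecidableEq V]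
    (G : SimpleGraph V) [DecidableRel G.Adj] (K : ℝ) {N : ℕ} (hN : 0 < N)
    (hrank : (K • 1 + G.adjMatrix ℝ).rank ≤ N) (hcard : 2 * N ≤ Fintype.card V) :
    ∃ m : ℤ, K = m ∧ |m| ≤ Fintype.card V := by
  have hfin := Matrix.finrank_eigenspace_toLin' (G.adjMatrix ℝ) K
  have hmapQ : (G.adjMatrix ℝ).charpoly = (G.adjMatrix ℚ).charpoly.map (algebraMap ℚ ℝ) := by
    rw [← Matrix.charpoly_map]
    congr 1
    ext i j
    simp [SimpleGraph.adjMatrix_apply, apply_ite]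
  have hmapZ : (G.adjMatrix ℝ).charpoly = (G.adjMatrix ℤ).charpoly.map (algebraMap ℤ ℝ) := by
    rw [← Matrix.charpoly_map]
    congr 1
    ext i j
    simp [SimpleGraph.adjMatrix_apply, apply_ite]
  have hmult : Fintype.card V - N ≤ (G.adjMatrix ℝ).charpoly.rootMultiplicity (-K) := by
    have := LinearMap.finrank_genEigenspace_le (Matrix.toLin' (G.adjMatrix ℝ)) (-K) 1
    rw [Matrix.charpoly_toLin'] at this
    have h2 : Fintype.card V - N ≤
        Module.finrank ℝ (Module.End.eigenspace (Matrix.toLin' (G.adjMatrix ℝ)) (-K)) := by omega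
    exact h2.trans this
  have hneR : (G.adjMatrix ℝ).charpoly ≠ 0 := (Matrix.charpoly_monic _).ne_zero
  have hroot : (G.adjMatrix ℝ).charpoly.IsRoot (-K) :=
    (rootMultiplicity_pos hneR).1 (by omega)
  have hintZ : IsIntegral ℤ (-K) :=
    ⟨_, Matrix.charpoly_monic (G.adjMatrix ℤ), by rw [hmapZ, IsRoot, eval_map] at hroot; exact hroot⟩
  have hintQ : IsIntegral ℚ (-K) := hintZ.tower_top
  have hmonic := Matrix.charpoly_monic (G.adjMatrix ℚ)
  rw [hmapQ] at hmult
  have hdvd := minpoly_pow_dvd_of_le_rootMultiplicity hintQ _ _ hmonic.ne_zero hmult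
  have hdegle := natDegree_le_of_dvd hdvd hmonic.ne_zero
  rw [natDegree_pow, Matrix.charpoly_natDegree_eq_dim] at hdegle
  have hpos := minpoly.natDegree_pos hintQ
  -- With `M` vertices, the degree `e` satisfies `(M - N) * e ≤ M` and `M ≥ 2 * N > 0`, so `e ≤ 2`.
  -- If `e = 2`, the power of the minimal polynomial is the whole characteristic polynomial.
  have hdeg1 : (minpoly ℚ (-K)).natDegree = 1 := by
    by_contra hne
    have h2 : (minpoly ℚ (-K)).natDegree = 2 := by
      by_contra hne2
      have h3 : 3 ≤ (minpoly ℚ (-K)).natDegree := by omega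
      have := (Nat.mul_le_mul_left (Fintype.card V - N) h3).trans hdegle
      omega
    rw [h2] at hdegle
    have : Nonempty V := Fintype.card_pos_iff.1 (by omega)
    refine G.charpoly_adjMatrix_ne_pow (minpoly.irreducible hintQ) (minpoly.monic hintQ) h2
      (Fintype.card V - N) ?_
    refine (eq_of_monic_of_dvd_of_natDegree_le ((minpoly.monic hintQ).pow _) hmonic hdvd ?_)
    rw [natDegree_pow, Matrix.charpoly_natDegree_eq_dim, h2]
    omega
  obtain ⟨q, hq⟩ := minpoly.natDegree_eq_one_iff.1 hdeg1
  rw [← hq, isIntegral_algebraMap_iff (algebraMap ℚ ℝ).injective,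
    IsIntegrallyClosed.isIntegral_iff] at hintZ
  obtain ⟨m, rfl⟩ := hintZ
  have hK : K = ((-m : ℤ) : ℝ) := by
    have : (m : ℝ) = -K := by simpa using hq
    push_cast
    linarith
  refine ⟨-m, hK, ?_⟩
  have heig : Module.End.HasEigenvalue (Matrix.toLin' (G.adjMatrix ℝ)) (-K) := by
    rw [Module.End.hasEigenvalue_iff]
    intro hbot
    rw [hbot, finrank_bot] at hfin
    omega
  -- Gershgorin's disc is centred at the zero diagonal entry.
  obtain ⟨k, hk⟩ := eigenvalue_mem_ball heig
  have hsum : ∑ j ∈ Finset.univ.erase k, ‖G.adjMatrix ℝ k j‖ ≤ Fintype.card V := by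
    refine (Finset.sum_le_card_nsmul _ _ 1 fun j _ => ?_).trans ?_
    · rw [SimpleGraph.adjMatrix_apply]
      split_ifs <;> simp
    · simp
  have hle := (mem_closedBall_iff_norm.1 hk).trans hsum
  rw [hK] at hle
  simp only [SimpleGraph.adjMatrix_apply, SimpleGraph.irrefl, if_false, sub_zero, norm_neg,
    Real.norm_eq_abs] at hle
  exact_mod_cast hle

/-! ### Lagrange values at zero and finiteness of the nodes -/

/-- The value at `0` of the `i`-th Lagrange basis polynomial with nodes `α`. -/
noncomputable def lagrangeAtZero {s : ℕ} (α : Fin s → ℝ) (i : Fin s) : ℝ :=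
  ∏ j ∈ Finset.univ.erase i, α j / (α j - α i)

-- Interpolation at `s` nodes is exact for `X ^ (k + 1)`, whose value at `0` is zero.
open Polynomial in
theorem sum_lagrangeAtZero_mul_pow {s : ℕ} {α : Fin s → ℝ} (hα : Function.Injective α) {k : ℕ}
    (hk : k + 1 < s) : ∑ i, lagrangeAtZero α i * α i ^ (k + 1) = 0 := by
  have h := Lagrange.eq_interpolate (s := Finset.univ) (v := α) (f := (X : ℝ[X]) ^ (k + 1))
    hα.injOn (by
      rw [degree_X_pow, Finset.card_univ, Fintype.card_fin]; exact_mod_cast hk)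
  have h0 := congrArg (eval 0) h
  rw [Lagrange.interpolate_apply, eval_finsetSum] at h0
  simp only [eval_pow, eval_X, eval_mul, eval_C, Lagrange.basis, eval_prod,
    Lagrange.basisDivisor, eval_sub, zero_sub] at h0
  rw [zero_pow k.succ_ne_zero] at h0
  rw [h0]
  refine Finset.sum_congr rfl fun i _ => ?_
  rw [mul_comm, lagrangeAtZero]
  congr 1
  refine Finset.prod_congr rfl fun j _ => ?_
  rw [← neg_sub (α i) (α j), div_neg, div_eq_mul_inv]
  ring

theorem lagrangeAtZero_ne_zero {s : ℕ} {α : Fin s → ℝ} (hα : Function.Injective α)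
    (h0 : ∀ i, α i ≠ 0) (i : Fin s) : lagrangeAtZero α i ≠ 0 := by
  refine Finset.prod_ne_zero_iff.2 fun j hj => div_ne_zero (h0 j) (sub_ne_zero.2 fun h => ?_)
  exact (Finset.mem_erase.1 hj).1 (hα h)

open Polynomial in
/-- A derivation kills pairwise separated elements, one of which is `1`, that satisfy weighted
power sum relations with nonzero constant weights. -/
theorem Derivation.eq_zero_of_weighted_power_sums {B M : Type*} [CommRing B] [Algebra ℝ B]
    [AddCommGroup M] [Module B M] [Module ℝ M] [IsScalarTower ℝ B M] (D : Derivation ℝ B M) {s : ℕ}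
    (x : Fin (s + 1) → B) (κ : Fin (s + 1) → ℝ) (hκ : ∀ i, κ i ≠ 0) (hlast : x (Fin.last s) = 1)
    (hsum : ∀ k, k < s → ∑ i, κ i • x i ^ (k + 1) = 0)
    (hunit : ∀ i j, i ≠ j → IsUnit (x i - x j)) (i : Fin (s + 1)) : D (x i) = 0 := by
  set w : Fin (s + 1) → M := fun i => κ i • D (x i) with hw
  have hpow : ∀ k, k < s → ∑ i, x i ^ k • w i = 0 := by
    intro k hk
    have h := congrArg D (hsum k hk)
    have h' : ((k + 1 : ℕ) : ℝ) • ∑ i, x i ^ k • w i = 0 := by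
      rw [map_sum, map_zero] at h
      rw [← h, Finset.smul_sum]
      refine Finset.sum_congr rfl fun i _ => ?_
      rw [D.map_smul, D.leibniz_pow, hw, Nat.add_sub_cancel]
      simp only [← Nat.cast_smul_eq_nsmul ℝ]
      rw [smul_comm (x i ^ k) (κ i), smul_comm ((k + 1 : ℕ) : ℝ) (κ i)]
    exact (smul_eq_zero_iff_right (by positivity)).1 h'
  have hpoly : ∀ f : B[X], f.natDegree < s → ∑ i, f.eval (x i) • w i = 0 := by
    intro f hf
    simp_rw [eval_eq_sum_range' hf, Finset.sum_smul, mul_smul]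
    rw [Finset.sum_comm]
    refine Finset.sum_eq_zero fun k hk => ?_
    rw [← Finset.smul_sum, hpow k (Finset.mem_range.1 hk), smul_zero]
  by_cases hi : i = Fin.last s
  · rw [hi, hlast, D.map_one_eq_zero]
  have hs : 0 < s := by
    rcases Nat.eq_zero_or_pos s with rfl | h
    · exact absurd (Fin.ext (by simp)) hi
    · exact h
  set T : Finset (Fin (s + 1)) := (Finset.univ.erase i).erase (Fin.last s) with hT
  have hcard : T.card = s - 1 := by
    rw [hT, Finset.card_erase_of_mem (by simp [Ne.symm hi]), Finset.card_erase_of_mem (by simp)]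
    simp
  -- This polynomial vanishes at every node except `x i` and the last one, where `w` is zero because
  -- `D 1 = 0`. Only the `i`-th term survives, with a unit coefficient.
  have h := hpoly (∏ j ∈ T, (X - C (x j))) (by
    refine lt_of_le_of_lt (natDegree_prod_le _ _) ?_
    refine lt_of_le_of_lt (Finset.sum_le_card_nsmul _ _ 1 fun j _ => natDegree_X_sub_C_le _) ?_
    rw [hcard]
    simp
    omega)
  rw [Finset.sum_eq_single i] at h
  · rw [eval_prod] at h
    have hu : IsUnit (∏ j ∈ T, eval (x i) (X - C (x j))) := by
      refine (IsUnit.prod_iff).2 fun j hj => ?_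
      simp only [eval_sub, eval_X, eval_C]
      exact hunit i j fun hij => by simp [hT, hij] at hj
    exact (smul_eq_zero_iff_right (hκ i)).1 (hu.smul_eq_zero.1 h)
  · intro j _ hji
    by_cases hj : j = Fin.last s
    · simp [hw, hj, hlast]
    · rw [eval_prod, Finset.prod_eq_zero (i := j) (by simp [hT, hj, hji]) (by simp), zero_smul]
  · simp

/-- Normalised families of nonzero distinct reals with prescribed Lagrange values at `0` are
finite in number: their coordinate ring is unramified over `ℝ`. -/
theorem finite_setOf_lagrangeAtZero_eq {s : ℕ} (κ : Fin (s + 1) → ℝ) :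
    {α : Fin (s + 1) → ℝ | Function.Injective α ∧ (∀ i, α i ≠ 0) ∧ α (Fin.last s) = 1 ∧
      lagrangeAtZero α = κ}.Finite := by
  set S := {α : Fin (s + 1) → ℝ | Function.Injective α ∧ (∀ i, α i ≠ 0) ∧ α (Fin.last s) = 1 ∧
      lagrangeAtZero α = κ}
  rcases S.eq_empty_or_nonempty with hemp | ⟨α₀, hα₀⟩
  · rw [hemp]; exact Set.finite_empty
  have hκ : ∀ i, κ i ≠ 0 := fun i => by
    rw [← hα₀.2.2.2]; exact lagrangeAtZero_ne_zero hα₀.1 hα₀.2.1 i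
  let X : Fin (s + 1) → S → ℝ := fun i α => α.1 i
  -- Adjoining these inverses makes the differences of distinct coordinates units. For equal indices
  -- the generator is `0⁻¹ = 0`, which is harmless.
  let U : Fin (s + 1) × Fin (s + 1) → S → ℝ := fun p α => (α.1 p.1 - α.1 p.2)⁻¹
  let gens : Set (S → ℝ) := Set.range X ∪ Set.range U
  let B := Algebra.adjoin ℝ gens
  have hgens : gens.Finite := (Set.finite_range X).union (Set.finite_range U)
  let x : Fin (s + 1) → B := fun i => ⟨X i, Algebra.subset_adjoin (Or.inl ⟨i, rfl⟩)⟩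
  let u : Fin (s + 1) × Fin (s + 1) → B := fun p => ⟨U p, Algebra.subset_adjoin (Or.inr ⟨p, rfl⟩)⟩
  have hxu : ∀ i j, i ≠ j → (x i - x j) * u (i, j) = 1 := by
    intro i j hij
    ext α
    exact mul_inv_cancel₀ (sub_ne_zero.2 fun h => hij (α.2.1 h))
  have hunit : ∀ i j, i ≠ j → IsUnit (x i - x j) := fun i j hij =>
    IsUnit.of_mul_eq_one _ (hxu i j hij)
  have hDx : ∀ i, KaehlerDifferential.D ℝ B (x i) = 0 := by
    refine Derivation.eq_zero_of_weighted_power_sums _ x κ hκ ?_ ?_ hunit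
    · ext α
      exact α.2.2.2.1
    · intro k hk
      ext α
      have := sum_lagrangeAtZero_mul_pow α.2.1 (k := k) (by omega)
      rw [α.2.2.2.2] at this
      simpa [x, X] using this
  have hDu : ∀ p, KaehlerDifferential.D ℝ B (u p) = 0 := by
    rintro ⟨i, j⟩
    by_cases hij : i = j
    · have : u (i, j) = 0 := by
        ext α
        simp [u, U, hij]
      rw [this, map_zero]
    · have h := congrArg (KaehlerDifferential.D ℝ B) (hxu i j hij)
      rw [Derivation.leibniz, map_sub, hDx, hDx, sub_zero, smul_zero, add_zero,
        Derivation.map_one_eq_zero] at h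
      exact (hunit i j hij).smul_eq_zero.1 h
  have hD : ∀ b : B, KaehlerDifferential.D ℝ B b = 0 := by
    intro b
    have hb : b ∈ Algebra.adjoin ℝ ((↑) ⁻¹' gens : Set B) := by
      rw [Algebra.adjoin_adjoin_coe_preimage]; trivial
    refine Derivation.eqOn_adjoin (D2 := 0) ?_ hb
    rintro ⟨_, _⟩ (⟨i, rfl⟩ | ⟨p, rfl⟩)
    · exact hDx i
    · exact hDu p
  have : Algebra.FormallyUnramified ℝ B := by
    refine ⟨?_⟩
    rw [← Submodule.subsingleton_iff B, ← subsingleton_iff_bot_eq_top,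
      ← KaehlerDifferential.span_range_derivation ℝ B, eq_comm, Submodule.span_eq_bot]
    rintro _ ⟨b, rfl⟩
    exact hD b
  have : Algebra.FiniteType ℝ B :=
    (Subalgebra.fg_iff_finiteType _).1 ⟨hgens.toFinset, by simp [B]⟩
  -- An unramified algebra of finite type over a field is finite-dimensional, so it has finitely
  -- many homomorphisms to `ℝ`; distinct points of `S` give distinct ones.
  have : Module.Finite ℝ B := Algebra.FormallyUnramified.finite_of_free ℝ B
  let ev : S → (B →ₐ[ℝ] ℝ) := fun α => (Pi.evalAlgHom ℝ (fun _ : S => ℝ) α).comp B.val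
  have hev : Function.Injective ev := by
    intro α β h
    ext i
    exact DFunLike.congr_fun h (x i)
  exact Set.finite_coe_iff.1 (Finite.of_injective ev hev)

/-! ### Congruence and distance tables -/

/-- Families of vectors with the same Gram matrix differ by a linear isometry. -/
theorem exists_linearIsometry_of_inner_eq {ι E : Type*} [NormedAddCommGroup E]
    [InnerProductSpace ℝ E] [FiniteDimensional ℝ E] (v w : ι → E)
    (h : ∀ i j, inner ℝ (v i) (v j) = inner ℝ (w i) (w j)) :
    ∃ f : E ≃ₗᵢ[ℝ] E, ∀ i, f (v i) = w i := by
  set L := Finsupp.linearCombination ℝ v with hL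
  set L' := Finsupp.linearCombination ℝ w with hL'
  have hnorm : ∀ c, ‖L c‖ = ‖L' c‖ := by
    intro c
    have : inner ℝ (L c) (L c) = inner ℝ (L' c) (L' c) := by
      simp only [hL, hL', Finsupp.linearCombination_apply, Finsupp.sum, sum_inner, inner_sum,
        real_inner_smul_left, real_inner_smul_right, h]
    rw [real_inner_self_eq_norm_sq, real_inner_self_eq_norm_sq] at this
    exact (sq_eq_sq₀ (norm_nonneg _) (norm_nonneg _)).1 this
  have hker : LinearMap.ker L ≤ LinearMap.ker L' := by
    intro c hc
    rw [LinearMap.mem_ker] at hc ⊢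
    rw [← norm_eq_zero, ← hnorm, hc, norm_zero]
  let g : LinearMap.range L →ₗ[ℝ] E :=
    (LinearMap.ker L).liftQ L' hker ∘ₗ L.quotKerEquivRange.symm.toLinearMap
  have hg : ∀ c, g ⟨L c, LinearMap.mem_range_self L c⟩ = L' c := by
    intro c
    have : L.quotKerEquivRange.symm ⟨L c, LinearMap.mem_range_self L c⟩ =
        (LinearMap.ker L).mkQ c := LinearMap.quotKerEquivRange_symm_apply_image L c _
    simp [g, this]
  let gi : LinearMap.range L →ₗᵢ[ℝ] E :=
    ⟨g, by rintro ⟨_, c, rfl⟩; rw [hg, ← hnorm]; rfl⟩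
  refine ⟨gi.extend.toLinearIsometryEquiv rfl, fun i => ?_⟩
  have hv : L (Finsupp.single i 1) = v i := by simp [hL]
  have hw : L' (Finsupp.single i 1) = w i := by simp [hL']
  have := gi.extend_apply ⟨L (Finsupp.single i 1), LinearMap.mem_range_self L _⟩
  rw [← hv, ← hw, ← hg]
  exact this

/-- Families of points with the same mutual distances are congruent. -/
theorem exists_isometryEquiv_of_dist_eq {ι E : Type*} [NormedAddCommGroup E]
    [InnerProductSpace ℝ E] [FiniteDimensional ℝ E] (p q : ι → E)
    (h : ∀ i j, dist (p i) (p j) = dist (q i) (q j)) : ∃ f : E ≃ᵢ E, ∀ i, f (p i) = q i := by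
  rcases isEmpty_or_nonempty ι with _ | ⟨⟨o⟩⟩
  · exact ⟨IsometryEquiv.refl E, fun i => isEmptyElim i⟩
  -- Polarization recovers the inner products based at `o` from the distances.
  obtain ⟨f, hf⟩ := exists_linearIsometry_of_inner_eq (fun i => p i - p o) (fun i => q i - q o) (by
    intro i j
    simp only [real_inner_eq_norm_mul_self_add_norm_mul_self_sub_norm_sub_mul_self_div_two,
      sub_sub_sub_cancel_right, ← dist_eq_norm, h])
  refine ⟨(IsometryEquiv.subRight (p o)).trans
    (f.toIsometryEquiv.trans (IsometryEquiv.addRight (q o))), fun i => ?_⟩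
  simpa using congrArg (· + q o) (hf i)

/-- Up to similarity there are finitely many sets of bounded size with distances in a fixed
finite set. -/
theorem finite_image_mk_similaritySetoid {d : ℕ} (𝓕 : Set (Set (EuclideanSpace ℝ (Fin d))))
    (B : ℕ) {R : Set ℝ} (hR : R.Finite)
    (h : ∀ X ∈ 𝓕, ∃ Y, (similaritySetoid d).r X Y ∧ Y.Finite ∧ Y.ncard ≤ B ∧
      ∀ x ∈ Y, ∀ y ∈ Y, dist x y ∈ R) :
    (Quotient.mk (similaritySetoid d) '' 𝓕).Finite := by
  classical
  have : Finite R := hR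
  -- Each table of distances is sent to the class of some realization; unrealizable tables get the
  -- class of the empty set as a dummy value.
  let C : (Σ n : Fin (B + 1), Fin n → Fin n → R) → Quotient (similaritySetoid d) := fun D =>
    if hD : ∃ p : Fin D.1 → EuclideanSpace ℝ (Fin d), ∀ i j, dist (p i) (p j) = D.2 i j then
      Quotient.mk _ (Set.range hD.choose) else Quotient.mk _ ∅
  refine (Set.finite_range C).subset ?_
  rintro _ ⟨X, hX, rfl⟩
  obtain ⟨Y, hXY, hfin, hcard, hdist⟩ := h X hX
  have : Finite Y := hfin
  let e : Fin Y.ncard ≃ Y := (Finite.equivFinOfCardEq (Nat.card_coe_set_eq Y)).symm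
  let p : Fin Y.ncard → EuclideanSpace ℝ (Fin d) := fun i => e i
  have hp : Set.range p = Y := by
    rw [show p = Subtype.val ∘ e from rfl, e.surjective.range_comp, Subtype.range_coe]
  refine ⟨⟨⟨Y.ncard, by omega⟩, fun i j => ⟨dist (p i) (p j), hdist _ (e i).2 _ (e j).2⟩⟩, ?_⟩
  have hD : ∃ q : Fin Y.ncard → EuclideanSpace ℝ (Fin d),
      ∀ i j, dist (q i) (q j) = dist (p i) (p j) := ⟨p, fun _ _ => rfl⟩
  have hC : C ⟨⟨Y.ncard, by omega⟩, fun i j => ⟨dist (p i) (p j), hdist _ (e i).2 _ (e j).2⟩⟩ =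
      Quotient.mk _ (Set.range hD.choose) := dif_pos hD
  rw [hC]
  refine Quotient.sound ((similaritySetoid d).iseqv.symm
    ((similaritySetoid d).iseqv.trans hXY ?_))
  obtain ⟨f, hf⟩ := exists_isometryEquiv_of_dist_eq p hD.choose fun i j => (hD.choose_spec i j).symm
  refine ⟨f.toDilationEquiv, ?_⟩
  refine (congrArg (f.toDilationEquiv '' ·) hp.symm).trans ((Set.range_comp _ p).symm.trans ?_)
  exact congrArg Set.range (funext hf)

/-! ### Ranks of distance matrices -/

theorem const_sub_dist_sq_mem_quadricSpan {V : Type*} {d : ℕ} (p : V → EuclideanSpace ℝ (Fin d))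
    (x : EuclideanSpace ℝ (Fin d)) (c : ℝ) :
    (fun v => c - dist x (p v) ^ 2) ∈ quadricSpan ℝ (fun j v => p v j : Fin d → V → ℝ) := by
  have h : (fun v => c - dist x (p v) ^ 2) = (c - ∑ j, x j ^ 2) • (1 : V → ℝ) +
      ((-1 : ℝ) • (∑ j, (fun v => p v j) ^ 2 : V → ℝ) +
        ∑ j, (2 * x j) • (fun v => p v j : V → ℝ)) := by
    ext v
    rw [EuclideanSpace.dist_eq, Real.sq_sqrt (Finset.sum_nonneg fun _ _ => sq_nonneg _)]
    simp only [Real.dist_eq, sq_abs, sub_sq, Finset.sum_add_distrib, Finset.sum_sub_distrib,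
      Pi.add_apply, Pi.smul_apply, Pi.one_apply, Finset.sum_apply, Pi.pow_apply, smul_eq_mul]
    ring
  rw [h, quadricSpan]
  refine Submodule.add_mem_sup (Submodule.smul_mem _ _ (Submodule.one_le.1 le_rfl))
    (Submodule.add_mem_sup (Submodule.smul_mem _ _ (Submodule.mem_span_singleton_self _)) ?_)
  exact Submodule.sum_mem _ fun j _ => Submodule.smul_mem _ _ (Submodule.subset_span ⟨j, rfl⟩)

/-- A matrix whose entries are a product of `k` factors `c - dist ^ 2` has small rank. -/
theorem rank_prod_const_sub_dist_sq_le {V ι : Type*} [Fintype V] {d : ℕ}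
    (p : V → EuclideanSpace ℝ (Fin d)) (T : Finset ι) (c : ι → ℝ) (t : ℝ) :
    (Matrix.of fun u v => t * ∏ j ∈ T, (c j - dist (p u) (p v) ^ 2)).rank ≤
      quadricDim d T.card := by
  classical
  have hmem : ∀ u, (fun v => ∏ j ∈ T, (c j - dist (p u) (p v) ^ 2)) ∈
      quadricSpan ℝ (fun j v => p v j : Fin d → V → ℝ) ^ T.card := by
    intro u
    induction T using Finset.induction_on with
    | empty =>
      simp only [Finset.prod_empty, Finset.card_empty, pow_zero]
      exact Submodule.one_le.1 (le_refl (1 : Submodule ℝ (V → ℝ)))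
    | insert a T ha ih =>
      rw [Finset.card_insert_of_notMem ha, pow_succ']
      simp only [Finset.prod_insert ha]
      exact Submodule.mul_mem_mul (const_sub_dist_sq_mem_quadricSpan p (p u) (c a)) ih
  rw [Matrix.rank_eq_finrank_span_row]
  refine (Submodule.finrank_mono ?_).trans
    (finrank_quadricSpan_pow_le (F := ℝ) (fun j v => p v j : Fin d → V → ℝ) T.card)
  rw [Submodule.span_le]
  rintro _ ⟨u, rfl⟩
  exact Submodule.smul_mem _ t (hmem u)

/-- The product over all distances vanishes off the diagonal; scaled by its value at distance zero
it gives the identity matrix, of full rank. -/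
theorem card_le_quadricDim {V ι : Type*} [Fintype V] [Fintype ι] {d : ℕ}
    (p : V → EuclideanSpace ℝ (Fin d)) (a : ι → ℝ) (ha : ∀ i, a i ≠ 0)
    (h : ∀ u v, u ≠ v → ∃ i, dist (p u) (p v) = a i) :
    Fintype.card V ≤ quadricDim d (Fintype.card ι) := by
  classical
  have hrank := rank_prod_const_sub_dist_sq_le p Finset.univ (fun i => a i ^ 2) (∏ i, a i ^ 2)⁻¹
  have hone : (Matrix.of fun u v => (∏ i, a i ^ 2)⁻¹ *
      ∏ j, (a j ^ 2 - dist (p u) (p v) ^ 2)) = (1 : Matrix V V ℝ) := by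
    ext u v
    rw [Matrix.of_apply, Matrix.one_apply]
    split_ifs with huv
    · rw [huv, dist_self]
      simp only [ne_eq, OfNat.ofNat_ne_zero, not_false_eq_true, zero_pow, sub_zero]
      exact inv_mul_cancel₀ (Finset.prod_ne_zero_iff.2 fun i _ => pow_ne_zero 2 (ha i))
    · obtain ⟨i, hi⟩ := h u v huv
      exact mul_eq_zero_of_right _ (Finset.prod_eq_zero (Finset.mem_univ i) (by rw [hi, sub_self]))
  rwa [hone, Matrix.rank_one, Finset.card_univ] at hrank

/-- In a large finite set with distances `a i`, the Lagrange values of the squared distances are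
bounded integers. -/
theorem exists_int_lagrangeAtZero_eq {V : Type*} [Fintype V] {d s : ℕ}
    (p : V → EuclideanSpace ℝ (Fin d)) (a : Fin (s + 1) → ℝ)
    (ha : ∀ i, 0 < a i) (hinj : Function.Injective a)
    (h : ∀ u v, u ≠ v → ∃ i, dist (p u) (p v) = a i)
    (hcard : 2 * quadricDim d s ≤ Fintype.card V) (i : Fin (s + 1)) :
    ∃ m : ℤ, lagrangeAtZero (fun i => a i ^ 2) i = m ∧ |m| ≤ Fintype.card V := by
  classical
  let G : SimpleGraph V :=
    { Adj := fun u v => u ≠ v ∧ dist (p u) (p v) = a i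
      symm := ⟨fun u v huv => ⟨huv.1.symm, by rw [dist_comm]; exact huv.2⟩⟩
      loopless := ⟨fun u hu => hu.1 rfl⟩ }
  have hpos : 0 < quadricDim d s := by
    cases s with
    | zero => exact one_pos
    | succ s => exact Nat.add_pos_left (Nat.choose_pos (by omega)) _
  refine G.exists_int_of_rank_le _ hpos ?_ hcard
  -- The scalar makes the entries equal to `1` at distance `a i`; the diagonal entries then become
  -- the Lagrange value.
  have hrank := rank_prod_const_sub_dist_sq_le p (Finset.univ.erase i) (fun i => a i ^ 2)
    (∏ j ∈ Finset.univ.erase i, (a j ^ 2 - a i ^ 2))⁻¹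
  rw [Finset.card_erase_of_mem (Finset.mem_univ i), Finset.card_univ, Fintype.card_fin,
    Nat.add_sub_cancel] at hrank
  convert hrank using 2
  ext u v
  simp only [Matrix.add_apply, Matrix.smul_apply, Matrix.one_apply, Matrix.of_apply,
    SimpleGraph.adjMatrix_apply, smul_eq_mul]
  have hsq : ∀ j ≠ i, a j ^ 2 - a i ^ 2 ≠ 0 := fun j hj => sub_ne_zero.2 fun hji =>
    hj (hinj ((sq_eq_sq₀ (ha j).le (ha i).le).1 hji))
  by_cases huv : u = v
  · subst huv
    simp [lagrangeAtZero, div_eq_inv_mul, Finset.prod_mul_distrib]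
  · obtain ⟨j, hj⟩ := h u v huv
    by_cases hji : j = i
    · have : G.Adj u v := ⟨huv, hji ▸ hj⟩
      rw [if_neg huv, if_pos this, hj, hji, mul_zero, zero_add, inv_mul_cancel₀]
      exact Finset.prod_ne_zero_iff.2 fun k hk => hsq k (Finset.mem_erase.1 hk).1
    · have : ¬ G.Adj u v := fun hadj => hji (hinj (hj.symm.trans hadj.2))
      rw [if_neg huv, if_neg this, mul_zero, zero_add, eq_comm]
      exact mul_eq_zero_of_right _ (Finset.prod_eq_zero (i := j) (by simp [hji]) (by simp [hj]))

/-! ### Normalisation and conclusion -/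

theorem lagrangeAtZero_div {s : ℕ} (α : Fin s → ℝ) {r : ℝ} (hr : r ≠ 0) :
    lagrangeAtZero (fun i => α i / r) = lagrangeAtZero α := by
  ext i
  refine Finset.prod_congr rfl fun j _ => ?_
  rw [← sub_div, div_div_div_cancel_right₀ hr]

/-- The normalised families of squared distances with Lagrange values bounded integers. -/
theorem finite_setOf_bounded_lagrangeAtZero (s B : ℕ) :
    {α : Fin (s + 1) → ℝ | Function.Injective α ∧ (∀ i, α i ≠ 0) ∧ α (Fin.last s) = 1 ∧
      ∀ i, ∃ m : ℤ, lagrangeAtZero α i = m ∧ |m| ≤ B}.Finite := by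
  have hfin : (Set.range fun m : Fin (s + 1) → Set.Icc (-(B : ℤ)) B =>
      fun i => ((m i : ℤ) : ℝ)).Finite := Set.finite_range _
  refine (hfin.biUnion fun κ _ => finite_setOf_lagrangeAtZero_eq κ).subset ?_
  rintro α ⟨hinj, h0, hlast, hm⟩
  choose m hm hB using hm
  refine Set.mem_biUnion (x := lagrangeAtZero α) ⟨fun i => ⟨m i, abs_le.1 (hB i)⟩, ?_⟩
    ⟨hinj, h0, hlast, rfl⟩
  ext i
  exact (hm i).symm

/-- Infinite sets must be excluded too, so the bound is tested on a finite subset with one point too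
many. -/
theorem encard_le_quadricDim {d s : ℕ} {X : Set (EuclideanSpace ℝ (Fin d))}
    (a : Fin (s + 1) → ℝ) (ha : ∀ i, 0 < a i) (hrange : Set.range a = distanceSet X) :
    X.encard ≤ quadricDim d (s + 1) := by
  by_contra! hlt
  obtain ⟨Y, hYX, hY⟩ := Set.exists_subset_encard_eq (Order.add_one_le_of_lt hlt)
  have hYfin : Y.Finite := Set.finite_of_encard_eq_coe (k := quadricDim d (s + 1) + 1) (by simpa)
  have := hYfin.fintype
  have h := card_le_quadricDim (fun y : Y => (y : EuclideanSpace ℝ (Fin d))) a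
    (fun i => (ha i).ne') fun u v huv => by
      have : dist (u : EuclideanSpace ℝ (Fin d)) v ∈ Set.range a :=
        hrange ▸ ⟨u, hYX u.2, v, hYX v.2, fun h => huv (Subtype.ext h), rfl⟩
      obtain ⟨i, hi⟩ := this
      exact ⟨i, hi.symm⟩
  rw [Fintype.card_fin, ← Nat.card_eq_fintype_card, Nat.card_coe_set_eq] at h
  rw [← hYfin.cast_ncard_eq] at hY
  have : Y.ncard = quadricDim d (s + 1) + 1 := by exact_mod_cast hY
  omega

/-- For a single distance the second binomial has lower entry `-1` and vanishes by convention. -/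
theorem two_mul_intBinom_add_eq (d s : ℕ) :
    2 * intBinom (d + (s + 1 : ℕ) - 1) ((s + 1 : ℕ) - 1) +
      2 * intBinom (d + (s + 1 : ℕ) - 2) ((s + 1 : ℕ) - 2) = 2 * quadricDim d s := by
  cases s with
  | zero => simp [intBinom, quadricDim]
  | succ s =>
    have h1 : ((d : ℤ) + (s + 1 + 1 : ℕ) - 1) = ((d + (s + 1) : ℕ) : ℤ) := by push_cast; ring
    have h2 : (((s + 1 + 1 : ℕ) : ℤ) - 1) = ((s + 1 : ℕ) : ℤ) := by push_cast; ring
    have h3 : ((d : ℤ) + (s + 1 + 1 : ℕ) - 2) = ((d + s : ℕ) : ℤ) := by push_cast; ring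
    have h4 : (((s + 1 + 1 : ℕ) : ℤ) - 2) = (s : ℤ) := by push_cast; ring
    rw [h1, h2, h3, h4, intBinom, intBinom, if_pos (by omega), if_pos (by omega)]
    simp only [Int.toNat_natCast, quadricDim]
    ring

theorem theorem4p3 (d s : ℕ) :
    (Quotient.mk (similaritySetoid d) ''
      {X : Set (EuclideanSpace ℝ (Fin d)) | IsSDistanceSet s X ∧
        ((2 * intBinom (d + s - 1) (s - 1) + 2 * intBinom (d + s - 2) (s - 2) : ℕ) : ℕ∞)
          ≤ X.encard}).Finite := by
  cases s with
  | zero =>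
    refine finite_image_mk_similaritySetoid _ 1 (Set.finite_singleton (0 : ℝ)) ?_
    rintro X ⟨hX, -⟩
    have hsub : X.Subsingleton := by
      intro x hx y hy
      by_contra hxy
      have hemp : distanceSet X = ∅ := by simpa [IsSDistanceSet] using hX
      exact Set.eq_empty_iff_forall_notMem.1 hemp _ ⟨x, hx, y, hy, hxy, rfl⟩
    refine ⟨X, (similaritySetoid d).iseqv.refl X, hsub.finite, ?_, fun x hx y hy => ?_⟩
    · have := hsub.finite.to_subtype
      exact Set.ncard_le_one_iff_subsingleton.2 hsub
    · rw [hsub hx hy, dist_self]; rfl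
  | succ s =>
    let B := quadricDim d (s + 1)
    let T := {α : Fin (s + 1) → ℝ | Function.Injective α ∧ (∀ i, α i ≠ 0) ∧ α (Fin.last s) = 1 ∧
      ∀ i, ∃ m : ℤ, lagrangeAtZero α i = m ∧ |m| ≤ B}
    have hT : T.Finite := finite_setOf_bounded_lagrangeAtZero s B
    -- Possible distances once the last one is scaled to `1`: `T` holds the squares, and `0`
    -- accounts for coinciding points.
    let R : Set ℝ := {0} ∪ ⋃ α ∈ T, Set.range fun i => √(α i)
    have hR : R.Finite := (Set.finite_singleton 0).union
      (hT.biUnion fun α _ => Set.finite_range _)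
    refine finite_image_mk_similaritySetoid _ B hR ?_
    rintro X ⟨hX, hlarge⟩
    rw [two_mul_intBinom_add_eq] at hlarge
    have hfinD : (distanceSet X).Finite := Set.finite_of_encard_eq_coe hX
    have : Finite (distanceSet X) := hfinD
    have hcardD : Nat.card (distanceSet X) = s + 1 := by
      rw [Nat.card_coe_set_eq, Set.ncard, hX]; rfl
    let e : Fin (s + 1) ≃ distanceSet X := (Finite.equivFinOfCardEq hcardD).symm
    let a : Fin (s + 1) → ℝ := fun i => e i
    have hrange : Set.range a = distanceSet X := by
      rw [show a = Subtype.val ∘ e from rfl, e.surjective.range_comp, Subtype.range_coe]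
    have hinj : Function.Injective a := Subtype.val_injective.comp e.injective
    have hpos : ∀ i, 0 < a i := by
      intro i
      obtain ⟨x, -, y, -, hxy, h⟩ := (e i).2
      change 0 < ((e i : distanceSet X) : ℝ)
      rw [← h]
      exact dist_pos.2 hxy
    have hXB : X.encard ≤ B := encard_le_quadricDim a hpos hrange
    have hXfin : X.Finite := Set.finite_of_encard_le_coe hXB
    have := hXfin.fintype
    have hcardX : Fintype.card X = X.ncard := by
      rw [← Nat.card_eq_fintype_card, Nat.card_coe_set_eq]
    rw [← hXfin.cast_ncard_eq, ← hcardX] at hlarge hXB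
    have hdist : ∀ x ∈ X, ∀ y ∈ X, x ≠ y → ∃ i, dist x y = a i := by
      intro x hx y hy hxy
      have : dist x y ∈ Set.range a := hrange ▸ ⟨x, hx, y, hy, hxy, rfl⟩
      obtain ⟨i, hi⟩ := this
      exact ⟨i, hi.symm⟩
    have hK := exists_int_lagrangeAtZero_eq (fun x : X => (x : EuclideanSpace ℝ (Fin d)))
      a hpos hinj
      (fun u v huv => hdist u u.2 v v.2 fun h => huv (Subtype.ext h)) (by exact_mod_cast hlarge)
    set r := a (Fin.last s) with hr
    have hr0 : 0 < r := hpos _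
    have hα : (fun i => a i ^ 2 / r ^ 2) ∈ T := by
      refine ⟨?_, fun i => by have := hpos i; positivity, div_self (by positivity), fun i => ?_⟩
      · intro i j hij
        have h2 : a i ^ 2 = a j ^ 2 := (div_left_inj' (by positivity)).1 hij
        exact hinj ((sq_eq_sq₀ (hpos i).le (hpos j).le).1 h2)
      · rw [lagrangeAtZero_div _ (by positivity)]
        obtain ⟨m, hm, hmB⟩ := hK i
        exact ⟨m, hm, hmB.trans (by exact_mod_cast hXB)⟩
    let f : EuclideanSpace ℝ (Fin d) ≃ᵈ EuclideanSpace ℝ (Fin d) :=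
      DilationEquiv.smulTorsor 0 (inv_ne_zero hr0.ne')
    have hf : ∀ x y, dist (f x) (f y) = dist x y / r := by
      intro x y
      simp [f, dist_smul₀, abs_of_pos hr0, div_eq_inv_mul]
    refine ⟨f '' X, ⟨f, rfl⟩, hXfin.image f, ?_, ?_⟩
    · refine (Set.ncard_image_le hXfin).trans ?_
      rw [← hcardX]
      exact_mod_cast hXB
    · rintro _ ⟨x, hx, rfl⟩ _ ⟨y, hy, rfl⟩
      by_cases hxy : x = y
      · exact Or.inl (by simp [hxy])
      · obtain ⟨i, hi⟩ := hdist x hx y hy hxy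
        refine Or.inr (Set.mem_biUnion hα ⟨i, ?_⟩)
        simp only
        rw [hf, hi, ← div_pow, Real.sqrt_sq (div_pos (hpos i) hr0).le]
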